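/- **Setting.** Let $\alpha>1$, let $\gamma_1,\gamma_2,\dots\ge 0$ be product weights, $\gamma_{\mathfrak u}=\prod_{j\in\mathfrak u}\gamma_j$, and for $\boldsymbol h\in\mathbb Z^d$ put $r_\alpha(\gamma,\boldsymbol h)=\prod_{j=1}^d r_\alpha(\gamma_j,h_j)$, where $r_\alpha(\gamma_j,0)=1$ and $r_\alpha(\gamma_j,h)=\gamma_j|h|^{-\alpha}$ for $h\ne0$. The weighted Korobov space of dimension $d$ consists of the continuous functions $f:[0,1]^d\to\mathbb C$ that are $1$-periodic in each variable and satisfy $\|f\|^2=\sum_{\boldsymbol h\in\mathbb Z^d}|\hat f(\boldsymbol h)|^2/r_\alpha(\gamma,\boldsymbol h)<\infty$, where $\hat f(\boldsymbol h)$ are the Fourier coefficients (with $0/0=0$, and $c/0=\infty$ for $c>0$). For $N\in\mathbb N$ and integers $z_1,\dots,z_d\ge 0$ the worst-case error is $$e(z_1,\dots,z_d)=\sup_{\|f\|\le1}\Big|\int_{[0,1]^d}f(\boldsymbol x)\,d\boldsymbol x-\frac1N\sum_{k=0}^{N-1}f\Big(\Big\{\frac{kz_1}{N}\Big\},\dots,\Big\{\frac{kz_d}{N}\Big\}\Big)\Big|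 .$$ **Algorithm.** Let $s,m\in\mathbb N=\{1,2,\dots\}$, let $b$ be prime, $N=b^m$, and let $0=w_1\le w_2\le\cdots$ be integers. Put $\mathcal Z_{N,w}=\{z\in\{1,\dots,b^{m-w}-1\}:\gcd(z,b^m)=1\}$ if $w<m$, and $\mathcal Z_{N,w}=\{1\}$ otherwise. The combined reduced, projection-corrected component-by-component (CBC) algorithm starts with $z_1=1$, $\mathcal E_1=\emptyset$, $\tilde z_1=1$. For $d=1,\dots,s-1$ it proceeds as follows. * If $w_{d+1}<m$, an exclusion set $\mathcal E_{d+1}\subsetneq\mathcal Z_{N,w_{d+1}}$ is chosen arbitrarily; then $z_{d+1}\in\mathcal Z_{N,w_{d+1}}\setminus\mathcal E_{d+1}$ is chosen to minimise $e^2(\tilde z_1,\dots,\tilde z_d,b^{w_{d+1}}z)$ over all $z\in\mathcal Z_{N,w_{d+1}}\setminus\mathcal E_{d+1}$, and $\tilde z_{d+1}=b^{w_{d+1}}z_{d+1}$. * If $w_{d+1}\ge m$, then $\tilde z_{d+1}=z_{d+1}=0$ and $\mathcal E_{d+1}=\emptyset$. **Theorem.** Let $\tilde{\boldsymbol z}=(\tilde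 z_1,\dots,\tilde z_s)$ be produced by this algorithm with exclusion sets $\mathcal E_1,\dots,\mathcal E_s$. Then for every $1\le d\le s$ and every $\lambda\in(1/\alpha,1]$, $$e^2(\tilde z_1,\dots,\tilde z_d)\le\Bigg(\sum_{\mathfrak u\subseteq\{1,\dots,d\}}\frac{\gamma_{\mathfrak u}^\lambda\,(4\zeta(\alpha\lambda))^{|\mathfrak u|}}{\phi\big(b^{\max\{0,\,m-\max_{j\in\mathfrak u}w_j\}}\big)}\prod_{j\in\mathfrak u}\frac{|\mathcal Z_{N,w_j}|}{|\mathcal Z_{N,w_j}|-|\mathcal E_j|}\Bigg)^{1/\lambda},$$ where $\zeta$ is the Riemann zeta function, $\phi$ is Euler's totient function, $\max\emptyset=0$, and empty products equal $1$. -/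

import Mathlib

open MeasureTheory
open scoped ENNReal

noncomputable section

/-- The Fourier weight `r_α(γ, h) = ∏ i, r_α(γ i, h i)` of a frequency vector `h`, where
`r_α(c, k) = 1` for `k = 0` and `r_α(c, k) = c / |k| ^ α` for `k ≠ 0`. -/
def korobovWeight {d : ℕ} (α : ℝ) (γ : Fin d → ℝ) (h : Fin d → ℤ) : ℝ :=
  ∏ i, if h i = 0 then 1 else γ i / |(h i : ℝ)| ^ α

/-- The norm of the weighted Korobov space of dimension `d`,
`‖f‖ = (∑ h, |f̂(h)|² / r_α(γ, h)) ^ (1/2)`, the sum running over all `h ∈ ℤ^d`.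
It takes the value `∞` exactly if `f` is not in the space: for `α > 1` the space consists of the
continuous functions on `[0,1]^d`, 1-periodic in each variable (that is, on the torus), for which
this sum is finite. If `r_α(γ, h) = 0`, then finiteness forces `f̂(h) = 0`
(in `ℝ≥0∞` one has `0 / 0 = 0` and `x / 0 = ∞` for `x ≠ 0`). -/
def korobovNorm {d : ℕ} (α : ℝ) (γ : Fin d → ℝ) (f : C(UnitAddTorus (Fin d), ℂ)) : ℝ≥0∞ :=
  (∑' h : Fin d → ℤ,
    ‖UnitAddTorus.mFourierCoeff f h‖ₑ ^ 2 / ENNReal.ofReal (korobovWeight α γ h)) ^ (1 / 2 : ℝ)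

/-- The `k`-th point `({k z_1 / N}, …, {k z_d / N})` of the rank-1 lattice point set with `N` points
and generating vector `z`, as a point of the torus. -/
def latticePoint {d : ℕ} (N : ℕ) (z : Fin d → ℕ) (k : ℕ) : UnitAddTorus (Fin d) :=
  fun i => (((k : ℝ) * (z i : ℝ) / (N : ℝ) : ℝ) : UnitAddCircle)

/-- The integration error of the quasi-Monte Carlo rule over the lattice point set. -/
def qmcError {d : ℕ} (N : ℕ) (z : Fin d → ℕ) (f : C(UnitAddTorus (Fin d), ℂ)) : ℂ :=
  (∫ x, f x) - (1 / (N : ℂ)) * ∑ k ∈ Finset.range N, f (latticePoint N z k)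

/-- The worst-case error: the supremum of the absolute integration error over the unit ball of the
weighted Korobov space. -/
def worstCaseError {d : ℕ} (α : ℝ) (γ : Fin d → ℝ) (N : ℕ) (z : Fin d → ℕ) : ℝ≥0∞ :=
  ⨆ (f : C(UnitAddTorus (Fin d), ℂ)) (_ : korobovNorm α γ f ≤ 1), ‖qmcError N z f‖ₑ

/-- `e²(z_1, …, z_d)` for sequences of weights and components indexed by `1, 2, 3, …`
(the values at index `0` are never used). -/
def sqError (α : ℝ) (γ : ℕ → ℝ) (N d : ℕ) (z : ℕ → ℕ) : ℝ≥0∞ :=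
  worstCaseError α (fun i : Fin d => γ (i + 1)) N (fun i : Fin d => z (i + 1)) ^ 2

/-- The reduced search space `𝒵_{N,w}` for `N = b ^ m`. -/
def searchSpace (b m w : ℕ) : Finset ℕ :=
  if w < m then (Finset.Icc 1 (b ^ (m - w) - 1)).filter (fun z => Nat.gcd z (b ^ m) = 1) else {1}

/-- The scaled vector `z̃_j = b ^ {w_j} z_j`. -/
def scaled (b : ℕ) (w z : ℕ → ℕ) : ℕ → ℕ := fun j => b ^ w j * z j

/-- `IsCBCRun α γ b m s w E z` says that `z_1, …, z_s` and the exclusion sets `E_1, …, E_s` form a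
run of the combined reduced, projection-corrected component-by-component algorithm. The components
with `w_j = 0` (where `𝒵_{N,0} = 𝒵_N` and `b ^ 0 = 1`) and those with `0 < w_j < m` are governed by
the same rule `step`. The vector returned by the run is `scaled b w z`. -/
structure IsCBCRun (α : ℝ) (γ : ℕ → ℝ) (b m s : ℕ) (w : ℕ → ℕ) (E : ℕ → Finset ℕ) (z : ℕ → ℕ) :
    Prop where
  /-- Initialisation. -/
  init : z 1 = 1 ∧ E 1 = ∅
  /-- While `w_{d+1} < m`: a proper subset of the search space is excluded, and the next component
  minimises the error of the scaled vector over what remains. -/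
  step : ∀ d : ℕ, 1 ≤ d → d + 1 ≤ s → w (d + 1) < m →
    E (d + 1) ⊂ searchSpace b m (w (d + 1)) ∧
    z (d + 1) ∈ searchSpace b m (w (d + 1)) \ E (d + 1) ∧
    ∀ x ∈ searchSpace b m (w (d + 1)) \ E (d + 1),
      sqError α γ (b ^ m) (d + 1) (scaled b w z) ≤
        sqError α γ (b ^ m) (d + 1) (scaled b w (Function.update z (d + 1) x))
  /-- Once `w_{d+1} ≥ m`: the remaining components are zero and nothing is excluded. -/
  final : ∀ d : ℕ, 1 ≤ d → d + 1 ≤ s → m ≤ w (d + 1) → z (d + 1) = 0 ∧ E (d + 1) = ∅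

end

/-!
The squared worst-case error of a rank-1 lattice rule equals the sum of the Fourier weights over the
nonzero elements `h` of the dual lattice, that is, those with `N ∣ h · z`
(`worstCaseError_sq_eq_dualSum`). Since `α > 1` makes the weights summable, functions in the unit
ball have absolutely convergent Fourier series, and Cauchy–Schwarz gives one inequality; suitable
trigonometric polynomials give the other.

The bound follows by induction on the dimension (`IsCBCRun.dualSum_rpow_le`). Passing from `d` to
`d + 1`, the dual sum gains the frequencies whose last component `k` is not zero. By minimality and
by subadditivity of `x ↦ x ^ λ`, the `λ`-th power of the new error exceeds that of the old one by at
most the average, over the candidates `x` that are not excluded, of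
`∑ r_α(γ, h) ^ λ γ_{d+1} ^ λ |k| ^ (-αλ)` over the new dual frequencies `(h, k)`
(`card_mul_dualSum_succ_rpow_le`). Interchanging the sums, one counts for fixed `(h, k)` the
candidates `x` with `b ^ m ∣ h · z̃ + k b ^ w x`. As the candidates are units modulo
`M = b ^ (m - w)`, there is some `g ≥ 1`, depending only on `h`, such that this number is at most `g`
and vanishes unless `g ∣ k` (`exists_card_filter_searchSpace_le`). Since
`∑_{g ∣ k} g |k| ^ (-αλ) ≤ ∑_k |k| ^ (-αλ) = 2 ζ(αλ)`, the sum over the candidates is at most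
`2 ζ(αλ) γ_{d+1} ^ λ ∏_{j ≤ d} (1 + 2 ζ(αλ) γ_j ^ λ)`. It is divided by the number
`φ(M) - |E_{d+1}|` of candidates not excluded. The terms of the asserted bound with `d + 1 ∈ u` add
up to at least this quotient (`cbcBound_succ`), because the maximum of the `w_j` over such `u` is
`w_{d+1}`.
-/

/-! ### Fourier coefficients and lattice points -/

/-- The condition that `h` is a nonzero element of the dual lattice of the rank-1 lattice rule with
`N` points and generating vector `z`. -/
def IsDualFreq {d : ℕ} (N : ℕ) (z : Fin d → ℕ) (h : Fin d → ℤ) : Prop :=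
  h ≠ 0 ∧ (N : ℤ) ∣ ∑ i, h i * (z i : ℤ)

lemma integral_eq_mFourierCoeff_zero {d : ℕ} (f : C(UnitAddTorus (Fin d), ℂ)) :
    ∫ x, f x = UnitAddTorus.mFourierCoeff f 0 := by
  have hvol : (volume : Measure UnitAddCircle) = AddCircle.haarAddCircle := by
    rw [AddCircle.volume_eq_smul_haarAddCircle]; simp
  change ∫ x, f x ∂(Measure.pi fun _ : Fin d => (volume : Measure UnitAddCircle)) =
    ∫ t, UnitAddTorus.mFourier (-0) t • f t
      ∂(Measure.pi fun _ : Fin d => (AddCircle.haarAddCircle : Measure UnitAddCircle))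
  rw [hvol]
  simp [UnitAddTorus.mFourier_zero]

lemma mFourierCoeff_sum_smul_mFourier {d : ℕ} (F : Finset (Fin d → ℤ)) (c : (Fin d → ℤ) → ℂ)
    (h : Fin d → ℤ) :
    UnitAddTorus.mFourierCoeff
      (∑ n ∈ F, c n • UnitAddTorus.mFourier n : C(UnitAddTorus (Fin d), ℂ)) h =
      if h ∈ F then c h else 0 := by
  classical
  rw [← UnitAddTorus.mFourierCoeff_toLp, ← UnitAddTorus.mFourierBasis_repr]
  have hb : ∀ n : Fin d → ℤ, UnitAddTorus.mFourierLp 2 n = UnitAddTorus.mFourierBasis n := fun n =>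
    (congrFun UnitAddTorus.coe_mFourierBasis n).symm
  simp only [map_sum, map_smul]
  change (∑ n ∈ F, c n • UnitAddTorus.mFourierBasis.repr (UnitAddTorus.mFourierLp 2 n)) h = _
  simp only [hb, HilbertBasis.repr_self, lp.coeFn_sum, Finset.sum_apply, lp.coeFn_smul,
    Pi.smul_apply, lp.single_apply, smul_eq_mul]
  rw [Finset.sum_congr rfl (g := fun n => if n = h then c n else 0)
    (fun n _ => by by_cases e : n = h
                   · subst e; simp
                   · rw [Pi.single_eq_of_ne (Ne.symm e)]; simp [e])]
  rw [Finset.sum_ite_eq']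

/-- Evaluated at the lattice points, a trigonometric monomial is a power of a fixed root of unity. -/
lemma mFourier_latticePoint {d : ℕ} {N : ℕ} (z : Fin d → ℕ) (h : Fin d → ℤ) (k : ℕ) :
    UnitAddTorus.mFourier h (latticePoint N z k) =
      (Complex.exp (2 * Real.pi * Complex.I / N) ^ (∑ i, h i * (z i : ℤ))) ^ k := by
  simp only [UnitAddTorus.mFourier, ContinuousMap.coe_mk, latticePoint, fourier_coe_apply]
  rw [← Complex.exp_sum, ← Complex.exp_int_mul, ← Complex.exp_nat_mul]
  congr 1
  push_cast
  rw [Finset.sum_mul, Finset.mul_sum]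
  refine Finset.sum_congr rfl fun i _ => ?_
  ring

/-- The character property of lattice points. -/
lemma average_mFourier_latticePoint {d : ℕ} {N : ℕ} (hN : N ≠ 0) (z : Fin d → ℕ) (h : Fin d → ℤ)
    [Decidable ((N : ℤ) ∣ ∑ i, h i * (z i : ℤ))] :
    (1 / (N : ℂ)) * ∑ k ∈ Finset.range N, UnitAddTorus.mFourier h (latticePoint N z k) =
      if (N : ℤ) ∣ ∑ i, h i * (z i : ℤ) then 1 else 0 := by
  have hprim := Complex.isPrimitiveRoot_exp N hN
  simp only [mFourier_latticePoint]
  set ω := Complex.exp (2 * Real.pi * Complex.I / N) ^ (∑ i, h i * (z i : ℤ)) with hω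
  have hNC : (N : ℂ) ≠ 0 := by exact_mod_cast hN
  split_ifs with hd
  · have : ω = 1 := (hprim.zpow_eq_one_iff_dvd _).2 hd
    simp [this, hNC]
  · have h1 : ω ≠ 1 := fun e => hd ((hprim.zpow_eq_one_iff_dvd _).1 e)
    have hpow : ω ^ N = 1 := by
      rw [hω, ← zpow_natCast, ← zpow_mul, mul_comm _ (N : ℤ), zpow_mul, zpow_natCast, hprim.pow_eq_one,
        one_zpow]
    rw [geom_sum_eq h1, hpow]
    simp

open Classical in
/-- For an absolutely convergent Fourier series, the integration error is the sum of the Fourier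
coefficients over the nonzero elements of the dual lattice, up to sign. -/
lemma qmcError_eq_tsum {d : ℕ} {N : ℕ} (hN : N ≠ 0) (z : Fin d → ℕ)
    (f : C(UnitAddTorus (Fin d), ℂ)) (hf : Summable (UnitAddTorus.mFourierCoeff f)) :
    qmcError N z f =
      -∑' h, if IsDualFreq N z h then UnitAddTorus.mFourierCoeff f h else 0 := by
  have h1 : HasSum (fun h => (1 / (N : ℂ)) * ∑ k ∈ Finset.range N,
      UnitAddTorus.mFourierCoeff f h • UnitAddTorus.mFourier h (latticePoint N z k))
      ((1 / (N : ℂ)) * ∑ k ∈ Finset.range N, f (latticePoint N z k)) :=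
    (hasSum_sum fun k _ =>
      UnitAddTorus.hasSum_mFourier_series_apply_of_summable hf (latticePoint N z k)).mul_left _
  have h2 : HasSum (fun h : Fin d → ℤ => if h = 0 then UnitAddTorus.mFourierCoeff f h else 0)
      (UnitAddTorus.mFourierCoeff f 0) := by
    convert hasSum_ite_eq (0 : Fin d → ℤ) (UnitAddTorus.mFourierCoeff f 0) using 2 with h
    split_ifs with e <;> simp [e]
  have h3 := (h2.sub h1).tsum_eq
  rw [qmcError, integral_eq_mFourierCoeff_zero, ← h3, ← tsum_neg]
  refine tsum_congr fun h => ?_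
  simp only [smul_eq_mul]
  rw [← Finset.mul_sum, mul_left_comm, average_mFourier_latticePoint hN]
  by_cases h0 : h = 0
  · simp [h0, IsDualFreq]
  · by_cases hd : (N : ℤ) ∣ ∑ i, h i * (z i : ℤ) <;> simp [h0, hd, IsDualFreq]

/-! ### The worst-case error and the dual lattice -/

open Classical in
/-- The sum of the Fourier weights over the nonzero elements of the dual lattice. -/
noncomputable def dualSum {d : ℕ} (α : ℝ) (γ : Fin d → ℝ) (N : ℕ) (z : Fin d → ℕ) : ℝ≥0∞ :=
  ∑' h, if IsDualFreq N z h then ENNReal.ofReal (korobovWeight α γ h) else 0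

lemma ENNReal.tsum_mul_le_sqrt_mul_sqrt {ι : Type*} [Countable ι] (f g : ι → ℝ≥0∞) :
    ∑' i, f i * g i ≤
      (∑' i, f i ^ (2 : ℝ)) ^ (1 / 2 : ℝ) * (∑' i, g i ^ (2 : ℝ)) ^ (1 / 2 : ℝ) := by
  let : MeasurableSpace ι := ⊤
  have h := ENNReal.lintegral_mul_le_Lp_mul_Lq (Measure.count : Measure ι)
    Real.HolderConjugate.two_two (measurable_of_countable f).aemeasurable
    (measurable_of_countable g).aemeasurable
  simpa only [lintegral_count, Pi.mul_apply] using h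

lemma korobovNorm_le_one_iff {d : ℕ} (α : ℝ) (γ : Fin d → ℝ) (f : C(UnitAddTorus (Fin d), ℂ)) :
    korobovNorm α γ f ≤ 1 ↔ ∑' h : Fin d → ℤ, ‖UnitAddTorus.mFourierCoeff f h‖ₑ ^ 2 /
      ENNReal.ofReal (korobovWeight α γ h) ≤ 1 := by
  rw [korobovNorm]
  nth_rewrite 1 [← ENNReal.one_rpow (1 / 2 : ℝ)]
  exact ENNReal.rpow_le_rpow_iff (by norm_num)

/-- Cauchy–Schwarz against the weights, for functions in the unit ball of the Korobov space. -/
lemma tsum_enorm_mFourierCoeff_le {d : ℕ} (α : ℝ) (γ : Fin d → ℝ)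
    (f : C(UnitAddTorus (Fin d), ℂ)) (hf : korobovNorm α γ f ≤ 1) (p : (Fin d → ℤ) → Prop)
    [DecidablePred p] :
    ∑' h, (if p h then ‖UnitAddTorus.mFourierCoeff f h‖ₑ else 0) ≤
      (∑' h, if p h then ENNReal.ofReal (korobovWeight α γ h) else 0) ^ (1 / 2 : ℝ) := by
  rw [korobovNorm_le_one_iff] at hf
  set a := fun h => ‖UnitAddTorus.mFourierCoeff f h‖ₑ
  set r := fun h => ENNReal.ofReal (korobovWeight α γ h)
  have hfin : ∀ h, a h ^ 2 / r h ≠ ⊤ := fun h =>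
    ne_top_of_le_ne_top ENNReal.one_ne_top ((ENNReal.le_tsum h).trans hf)
  -- a vanishing weight forces the Fourier coefficient to vanish
  have hzero : ∀ h, r h = 0 → a h = 0 := fun h h0 => by
    by_contra hne
    exact hfin h (by rw [h0, ENNReal.div_zero (pow_ne_zero 2 hne)])
  have hle : ∀ h, (if p h then a h else 0) =
      (a h ^ 2 / r h) ^ (1 / 2 : ℝ) * (if p h then r h else 0) ^ (1 / 2 : ℝ) := fun h => by
    by_cases hp : p h
    · simp only [hp, if_true]
      by_cases h0 : r h = 0
      · simp [hzero h h0, h0]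
      · rw [← ENNReal.mul_rpow_of_nonneg _ _ (by norm_num),
          ENNReal.div_mul_cancel h0 ENNReal.ofReal_ne_top, ← ENNReal.rpow_natCast,
          ← ENNReal.rpow_mul]
        norm_num
    · simp [hp]
  calc ∑' h, (if p h then a h else 0)
      = ∑' h, (a h ^ 2 / r h) ^ (1 / 2 : ℝ) * (if p h then r h else 0) ^ (1 / 2 : ℝ) :=
        tsum_congr hle
    _ ≤ _ := ENNReal.tsum_mul_le_sqrt_mul_sqrt _ _
    _ = (∑' h, a h ^ 2 / r h) ^ (1 / 2 : ℝ) * (∑' h, if p h then r h else 0) ^ (1 / 2 : ℝ) := by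
        simp only [← ENNReal.rpow_mul]
        norm_num
    _ ≤ 1 ^ (1 / 2 : ℝ) * (∑' h, if p h then r h else 0) ^ (1 / 2 : ℝ) := by
        gcongr
    _ = _ := by simp [r]

/-- The upper bound for the worst-case error: expand the integrand into its Fourier series. -/
lemma worstCaseError_sq_le_dualSum {d : ℕ} {α : ℝ} {γ : Fin d → ℝ} {N : ℕ} (hN : N ≠ 0)
    (z : Fin d → ℕ) (hfin : ∑' h, ENNReal.ofReal (korobovWeight α γ h) ≠ ⊤) :
    worstCaseError α γ N z ^ 2 ≤ dualSum α γ N z := by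
  classical
  have hroot : worstCaseError α γ N z ≤ dualSum α γ N z ^ (1 / 2 : ℝ) := by
    refine iSup₂_le fun f hf => ?_
    have hsum : Summable (UnitAddTorus.mFourierCoeff f) := by
      have h1 := tsum_enorm_mFourierCoeff_le α γ f hf (fun _ => True)
      simp only [if_true] at h1
      have h2 : ∑' h, ‖UnitAddTorus.mFourierCoeff f h‖ₑ ≠ ⊤ :=
        ne_top_of_le_ne_top (ENNReal.rpow_ne_top_of_nonneg (by norm_num) hfin) h1
      refine Summable.of_nnnorm ?_
      exact ENNReal.tsum_coe_ne_top_iff_summable.1 h2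
    rw [qmcError_eq_tsum hN z f hsum, enorm_neg]
    refine (enorm_tsum_le_tsum_enorm).trans ?_
    refine le_trans (le_of_eq (tsum_congr fun h => ?_))
      (tsum_enorm_mFourierCoeff_le α γ f hf (IsDualFreq N z))
    split_ifs <;> simp
  calc worstCaseError α γ N z ^ 2 ≤ (dualSum α γ N z ^ (1 / 2 : ℝ)) ^ 2 := by gcongr
    _ = dualSum α γ N z := by
      rw [← ENNReal.rpow_natCast, ← ENNReal.rpow_mul]; norm_num

/-- The lower bound for the worst-case error: test with the trigonometric polynomials whose Fourier
coefficients are proportional to the weights on a finite part of the dual lattice. -/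
lemma dualSum_le_worstCaseError_sq {d : ℕ} {α : ℝ} {γ : Fin d → ℝ} {N : ℕ} (hN : N ≠ 0)
    (z : Fin d → ℕ) (hw : ∀ h, 0 ≤ korobovWeight α γ h) :
    dualSum α γ N z ≤ worstCaseError α γ N z ^ 2 := by
  classical
  refine ENNReal.summable.tsum_le_of_sum_le fun F => ?_
  set G := F.filter (IsDualFreq N z)
  set S := ∑ h ∈ G, korobovWeight α γ h with hS
  have hS0 : 0 ≤ S := Finset.sum_nonneg fun h _ => hw h
  rw [← Finset.sum_filter, ← ENNReal.ofReal_sum_of_nonneg fun h _ => hw h]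
  change ENNReal.ofReal S ≤ _
  rcases hS0.eq_or_lt with h0 | hpos
  · simp [← h0]
  set f : C(UnitAddTorus (Fin d), ℂ) :=
    ∑ h ∈ G, ((korobovWeight α γ h / √S : ℝ) : ℂ) • UnitAddTorus.mFourier h
  have hcoeff : ∀ h, UnitAddTorus.mFourierCoeff f h =
      if h ∈ G then ((korobovWeight α γ h / √S : ℝ) : ℂ) else 0 :=
    mFourierCoeff_sum_smul_mFourier G _
  have hsum : Summable (UnitAddTorus.mFourierCoeff f) :=
    summable_of_ne_finset_zero (s := G) fun h hh => by simp [hcoeff, hh]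
  have hnorm : korobovNorm α γ f ≤ 1 := by
    rw [korobovNorm_le_one_iff]
    have hterm : ∀ h, ‖UnitAddTorus.mFourierCoeff f h‖ₑ ^ 2 /
        ENNReal.ofReal (korobovWeight α γ h) =
        if h ∈ G then ENNReal.ofReal (korobovWeight α γ h / S) else 0 := fun h => by
      rw [hcoeff]
      split_ifs with hh
      · rcases (hw h).eq_or_lt with e | hp
        · simp [← e]
        · rw [← ofReal_norm, ← ENNReal.ofReal_pow (norm_nonneg _), ← ENNReal.ofReal_div_of_pos hp,
            Complex.norm_real, Real.norm_of_nonneg (by positivity), div_pow, Real.sq_sqrt hS0]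
          congr 1
          field_simp
      · simp
    simp only [hterm]
    rw [tsum_eq_sum (s := G) fun h hh => by simp [hh], Finset.sum_ite_mem, Finset.inter_self,
      ← ENNReal.ofReal_sum_of_nonneg fun h _ => div_nonneg (hw h) hS0, ← Finset.sum_div,
      div_self hpos.ne']
    simp
  have herr : ‖qmcError N z f‖ₑ = ENNReal.ofReal (√S) := by
    rw [qmcError_eq_tsum hN z f hsum, enorm_neg, tsum_eq_sum (s := G) fun h hh => by
      simp [hcoeff, hh]]
    rw [Finset.sum_congr rfl (g := fun h => ((korobovWeight α γ h / √S : ℝ) : ℂ))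
      (fun h hh => by rw [if_pos (Finset.mem_filter.1 hh).2, hcoeff, if_pos hh]),
      ← Complex.ofReal_sum, ← Finset.sum_div, ← ofReal_norm, Complex.norm_real,
      ← hS, Real.div_sqrt, Real.norm_of_nonneg (Real.sqrt_nonneg _)]
  calc ENNReal.ofReal S = ENNReal.ofReal (√S) ^ 2 := by
        rw [← ENNReal.ofReal_pow (Real.sqrt_nonneg _), Real.sq_sqrt hS0]
    _ ≤ worstCaseError α γ N z ^ 2 := by
        rw [← herr]
        gcongr
        exact le_iSup₂ (f := fun (f : C(UnitAddTorus (Fin d), ℂ)) (_ : korobovNorm α γ f ≤ 1) =>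
          ‖qmcError N z f‖ₑ) f hnorm

/-! ### Power sums over multiples -/

/-- The function `k ↦ |k| ^ (-β)` on the nonzero integers, extended by `0`. -/
noncomputable def absPow (β : ℝ) (k : ℤ) : ℝ≥0∞ :=
  if k = 0 then 0 else ENNReal.ofReal ((|(k : ℝ)| ^ β)⁻¹)

lemma absPow_rpow (β : ℝ) {t : ℝ} (ht : 0 < t) (k : ℤ) : absPow β k ^ t = absPow (β * t) k := by
  unfold absPow
  split_ifs with h
  · simp [ht]
  · rw [ENNReal.ofReal_rpow_of_nonneg (by positivity) ht.le, Real.inv_rpow (by positivity),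
      Real.rpow_mul (abs_nonneg _)]

lemma tsum_absPow {β : ℝ} (hβ : 1 < β) :
    ∑' k, absPow β k = ENNReal.ofReal (2 * (riemannZeta (β : ℂ)).re) := by
  have hs : Summable fun n : ℕ => (((n : ℝ) + 1) ^ β)⁻¹ := by
    have h := (summable_nat_add_iff 1).2 (Real.summable_nat_rpow_inv.2 hβ)
    simpa using h
  have hz : (riemannZeta (β : ℂ)).re = ∑' n : ℕ, (((n : ℝ) + 1) ^ β)⁻¹ := by
    rw [zeta_eq_tsum_one_div_nat_add_one_cpow (by simpa using hβ)]
    have : ∀ n : ℕ, 1 / ((n : ℂ) + 1) ^ (β : ℂ) = (((((n : ℝ) + 1) ^ β)⁻¹ : ℝ) : ℂ) := fun n => by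
      rw [Complex.ofReal_inv, Complex.ofReal_cpow (by positivity)]
      simp
    simp only [this]
    rw [← Complex.ofReal_tsum, Complex.ofReal_re]
  have hpos : ∀ n : ℕ, absPow β ((n : ℤ) + 1) = ENNReal.ofReal ((((n : ℝ) + 1) ^ β)⁻¹) := fun n => by
    have h0 : (n : ℤ) + 1 ≠ 0 := by positivity
    rw [absPow, if_neg h0]
    push_cast
    rw [abs_of_nonneg (by positivity)]
  have hneg : ∀ n : ℕ, absPow β (-((n : ℤ) + 1)) = ENNReal.ofReal ((((n : ℝ) + 1) ^ β)⁻¹) :=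
    fun n => by
      have h0 : -((n : ℤ) + 1) ≠ 0 := by rw [neg_ne_zero]; positivity
      rw [absPow, if_neg h0]
      push_cast
      rw [abs_neg, abs_of_nonneg (by positivity)]
  rw [tsum_of_add_one_of_neg_add_one ENNReal.summable ENNReal.summable]
  simp only [hpos, hneg]
  rw [← ENNReal.ofReal_tsum_of_nonneg (fun n => by positivity) hs, hz, two_mul,
    ENNReal.ofReal_add (tsum_nonneg fun n => by positivity) (tsum_nonneg fun n => by positivity)]
  simp [absPow]

lemma natCast_mul_absPow_mul_le {β : ℝ} (hβ : 1 ≤ β) {g : ℕ} (hg : 1 ≤ g) (k : ℤ) :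
    (g : ℝ≥0∞) * absPow β (g * k) ≤ absPow β k := by
  have hg0 : (0 : ℝ) < g := by exact_mod_cast hg
  unfold absPow
  by_cases h : k = 0
  · simp [h]
  · have h2 : (g : ℤ) * k ≠ 0 := mul_ne_zero (by positivity) h
    have hk : (0 : ℝ) < |(k : ℝ)| := abs_pos.2 (by exact_mod_cast h)
    rw [if_neg h, if_neg h2, ← ENNReal.ofReal_natCast, ← ENNReal.ofReal_mul hg0.le]
    refine ENNReal.ofReal_le_ofReal ?_
    push_cast
    rw [abs_mul, Nat.abs_cast, Real.mul_rpow hg0.le hk.le, mul_inv, ← mul_assoc]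
    refine mul_le_of_le_one_left (by positivity) ?_
    rw [← div_eq_mul_inv, div_le_one (by positivity)]
    exact Real.self_le_rpow_of_one_le (by exact_mod_cast hg) hβ

lemma tsum_multiples_absPow_le {β : ℝ} (hβ : 1 ≤ β) {g : ℕ} (hg : 1 ≤ g) :
    ∑' k : ℤ, (if (g : ℤ) ∣ k then (g : ℝ≥0∞) else 0) * absPow β k ≤ ∑' k, absPow β k := by
  have hg0 : (g : ℤ) ≠ 0 := by positivity
  rw [← (mul_right_injective₀ hg0).tsum_eq (f := fun k : ℤ =>
    (if (g : ℤ) ∣ k then (g : ℝ≥0∞) else 0) * absPow β k)]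
  · refine ENNReal.tsum_le_tsum fun k => ?_
    simpa using natCast_mul_absPow_mul_le hβ hg k
  · intro k hk
    by_contra hne
    refine hk ?_
    have : ¬ (g : ℤ) ∣ k := fun ⟨j, hj⟩ => hne ⟨j, hj.symm⟩
    simp [this]

/-! ### Counting candidates of the search space -/

/-- A linear congruence modulo `M` with leading coefficient `k` has at most `gcd(M, k)` solutions in
`{0, …, M - 1}`. -/
lemma card_filter_dvd_add_mul_le {M : ℕ} (hM : 0 < M) (A : Finset ℕ) (hA : ∀ x ∈ A, x < M)
    (a k : ℤ) :
    (A.filter fun x : ℕ => (M : ℤ) ∣ a + k * (x : ℤ)).card ≤ Int.gcd M k := by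
  set g := Int.gcd M k with hg
  have hgM : g ∣ M := by
    have := Int.gcd_dvd_left (M : ℤ) k
    exact_mod_cast this
  have hgpos : 0 < g := Nat.pos_of_dvd_of_pos hgM hM
  obtain ⟨q, hq⟩ := hgM
  have hdiv : (M : ℤ) / (g : ℤ) = (q : ℤ) := by
    rw [hq]; push_cast
    exact Int.mul_ediv_cancel_left _ (by positivity)
  -- the solutions lie in one residue class modulo `q = M / g`, hence are determined by `x / q`
  rw [← Finset.card_range g]
  refine Finset.card_le_card_of_injOn (fun x => x / q) (fun x hx => ?_) (fun x hx y hy hxy => ?_)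
  · have hx' := hA x (Finset.mem_filter.1 (Finset.mem_coe.1 hx)).1
    simp only [Finset.coe_range, Set.mem_Iio]
    exact Nat.div_lt_of_lt_mul (by rw [mul_comm, ← hq]; exact hx')
  · have hx2 := (Finset.mem_filter.1 (Finset.mem_coe.1 hx)).2
    have hy2 := (Finset.mem_filter.1 (Finset.mem_coe.1 hy)).2
    have hmod : k * (x : ℤ) ≡ k * (y : ℤ) [ZMOD (M : ℤ)] := by
      rw [Int.modEq_iff_dvd]
      have := dvd_sub hy2 hx2
      simpa using this
    have h3 := Int.ModEq.cancel_left_div_gcd (by exact_mod_cast hM) hmod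
    rw [← hg, hdiv, Int.natCast_modEq_iff] at h3
    have h4 : x % q = y % q := h3
    simp only at hxy
    rw [← Nat.div_add_mod x q, ← Nat.div_add_mod y q, hxy, h4]

lemma mem_searchSpace_iff {b m w : ℕ} (hb : b.Prime) (hw : w < m) {x : ℕ} :
    x ∈ searchSpace b m w ↔ x < b ^ (m - w) ∧ Nat.Coprime (b ^ (m - w)) x := by
  have hm : 0 < m - w := by omega
  have h2 : 2 ≤ b ^ (m - w) := hb.two_le.trans (Nat.le_self_pow hm.ne' b)
  have hco : Nat.gcd x (b ^ m) = 1 ↔ Nat.Coprime (b ^ (m - w)) x := by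
    rw [← Nat.coprime_iff_gcd_eq_one, Nat.coprime_comm, Nat.coprime_pow_left_iff (by omega),
      Nat.coprime_pow_left_iff hm]
  rw [searchSpace, if_pos hw, Finset.mem_filter, Finset.mem_Icc, hco]
  constructor
  · rintro ⟨⟨_, h⟩, h'⟩
    exact ⟨by omega, h'⟩
  · rintro ⟨h, h'⟩
    refine ⟨⟨Nat.pos_of_ne_zero ?_, by omega⟩, h'⟩
    rintro rfl
    rw [Nat.coprime_zero_right] at h'
    omega

lemma card_searchSpace {b m w : ℕ} (hb : b.Prime) :
    (searchSpace b m w).card = Nat.totient (b ^ (m - w)) := by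
  by_cases hw : w < m
  · rw [Nat.totient_eq_card_coprime]
    congr 1
    ext x
    rw [mem_searchSpace_iff hb hw, Finset.mem_filter, Finset.mem_range]
  · have : m - w = 0 := by omega
    simp [searchSpace, hw, this]

/-- For a fixed partial scalar product `c` and a last frequency `k`, few candidates from the search
space put the frequency into the dual lattice. With `c = b ^ w * a`, the relevant `g` is
`gcd(a, b ^ (m - w))`: since the candidates are units, solvability forces
`gcd(k, b ^ (m - w)) = g`. -/
lemma exists_card_filter_searchSpace_le {b m w : ℕ} (hb : b.Prime) (c : ℤ) :
    ∃ g : ℕ, 1 ≤ g ∧ ∀ k : ℤ, ((searchSpace b m w).filter fun x =>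
      ((b ^ m : ℕ) : ℤ) ∣ c + k * ((b ^ w * x : ℕ) : ℤ)).card ≤ if (g : ℤ) ∣ k then g else 0 := by
  by_cases hw : w < m
  swap
  · refine ⟨1, le_rfl, fun k => ?_⟩
    refine (Finset.card_filter_le _ _).trans ?_
    simp [searchSpace, hw]
  have hbw : ((b : ℤ) ^ w) ≠ 0 := pow_ne_zero _ (by exact_mod_cast hb.ne_zero)
  have hpow : (b : ℤ) ^ m = b ^ w * b ^ (m - w) := by rw [← pow_add]; congr 1; omega
  by_cases hc : (b : ℤ) ^ w ∣ c
  swap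
  · refine ⟨1, le_rfl, fun k => ?_⟩
    rw [Finset.filter_false_of_mem]
    · simp
    · intro x _ hx
      push_cast at hx
      refine hc ((Int.dvd_iff_dvd_of_dvd_add ((Dvd.intro _ hpow.symm).trans hx)).2 ?_)
      exact ⟨k * x, by ring⟩
  obtain ⟨a, rfl⟩ := hc
  set M := b ^ (m - w) with hMdef
  have hM : 0 < M := pow_pos hb.pos _
  have hiff : ∀ (k : ℤ) (x : ℕ), ((b ^ m : ℕ) : ℤ) ∣ (b : ℤ) ^ w * a + k * ((b ^ w * x : ℕ) : ℤ) ↔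
      (M : ℤ) ∣ a + k * (x : ℤ) := fun k x => by
    rw [← mul_dvd_mul_iff_left hbw (b := (M : ℤ)), hMdef]
    push_cast
    rw [← hpow]
    ring_nf
  simp only [hiff]
  refine ⟨Int.gcd M a, Int.gcd_pos_of_ne_zero_left _ (by exact_mod_cast hM.ne'), fun k => ?_⟩
  rcases Finset.eq_empty_or_nonempty
    ((searchSpace b m w).filter fun x : ℕ => (M : ℤ) ∣ a + k * (x : ℤ)) with he | ⟨x, hx⟩
  · simp [he]
  rw [Finset.mem_filter, mem_searchSpace_iff hb hw] at hx
  obtain ⟨⟨_, hco⟩, hdvd⟩ := hx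
  have hgk : ((Int.gcd M a : ℕ) : ℤ) ∣ k := by
    have h1 : ((Int.gcd M a : ℕ) : ℤ) ∣ k * x :=
      (Int.dvd_iff_dvd_of_dvd_add ((Int.gcd_dvd_left _ _).trans hdvd)).1 (Int.gcd_dvd_right _ _)
    refine IsCoprime.dvd_of_dvd_mul_right ?_ h1
    exact (Nat.isCoprime_iff_coprime.2 hco).of_isCoprime_of_dvd_left (Int.gcd_dvd_left _ _)
  have hle : Int.gcd M k ≤ Int.gcd M a := by
    refine Nat.le_of_dvd (Int.gcd_pos_of_ne_zero_left _ (by exact_mod_cast hM.ne')) ?_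
    refine Int.dvd_gcd (Int.gcd_dvd_left _ _) ?_
    refine (Int.dvd_iff_dvd_of_dvd_add ((Int.gcd_dvd_left _ _).trans hdvd)).2 ?_
    exact (Int.gcd_dvd_right _ _).mul_right _
  rw [if_pos hgk]
  exact (card_filter_dvd_add_mul_le hM _
    (fun x hx => ((mem_searchSpace_iff hb hw).1 hx).1) a k).trans hle

open Classical in
/-- Summing `|k| ^ (-β)` over the frequencies made dual by a candidate, and then over all candidates
of the search space, costs no more than the sum over all `k ≠ 0` taken once. -/
lemma sum_searchSpace_tsum_absPow_le {b m w : ℕ} (hb : b.Prime) {β : ℝ} (hβ : 1 ≤ β)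
    {A : Finset ℕ} (hA : A ⊆ searchSpace b m w) (c : ℤ) :
    ∑ x ∈ A, ∑' k : ℤ,
      (if ((b ^ m : ℕ) : ℤ) ∣ c + k * ((b ^ w * x : ℕ) : ℤ) then absPow β k else 0) ≤
      ∑' k, absPow β k := by
  obtain ⟨g, hg1, hg⟩ := exists_card_filter_searchSpace_le (m := m) (w := w) hb c
  refine le_trans ?_ (tsum_multiples_absPow_le hβ hg1)
  rw [← Summable.tsum_finsetSum fun _ _ => ENNReal.summable]
  refine ENNReal.tsum_le_tsum fun k => ?_
  rw [← Finset.sum_filter, Finset.sum_const, nsmul_eq_mul]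
  gcongr
  have h1 := (Finset.card_le_card (Finset.filter_subset_filter
    (fun x : ℕ => ((b ^ m : ℕ) : ℤ) ∣ c + k * ((b ^ w * x : ℕ) : ℤ)) hA)).trans (hg k)
  calc _ ≤ (((if (g : ℤ) ∣ k then g else 0 : ℕ)) : ℝ≥0∞) := by
        exact_mod_cast le_trans (le_of_eq (by congr)) h1
    _ = _ := by split_ifs <;> simp

/-! ### Sums of Fourier weights -/

lemma ENNReal.tsum_fin_prod (d : ℕ) (f : Fin d → ℤ → ℝ≥0∞) :
    ∑' h : Fin d → ℤ, ∏ i, f i (h i) = ∏ i, ∑' k, f i k := by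
  induction d with
  | zero => simp
  | succ d ih =>
    rw [← (Fin.snocEquiv fun _ : Fin (d + 1) => ℤ).tsum_eq, ENNReal.tsum_prod',
      Fin.prod_univ_castSucc, mul_comm, ← ih, ← ENNReal.tsum_mul_right]
    refine tsum_congr fun k => ?_
    rw [← ENNReal.tsum_mul_left]
    refine tsum_congr fun h => ?_
    rw [Fin.prod_univ_castSucc, mul_comm]
    simp [Fin.snocEquiv]

/-- Subadditivity of `x ↦ x ^ t` for `0 < t ≤ 1`, for arbitrary sums. -/
lemma ENNReal.tsum_rpow_le_tsum_rpow {ι : Type*} (f : ι → ℝ≥0∞) {t : ℝ} (ht : 0 < t)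
    (ht1 : t ≤ 1) : (∑' i, f i) ^ t ≤ ∑' i, f i ^ t := by
  classical
  have hfin : ∀ F : Finset ι, (∑ i ∈ F, f i) ^ t ≤ ∑ i ∈ F, f i ^ t := fun F => by
    induction F using Finset.induction_on with
    | empty => simp [ht]
    | insert i F hi ih =>
      rw [Finset.sum_insert hi, Finset.sum_insert hi]
      exact (ENNReal.rpow_add_le_add_rpow _ _ ht.le ht1).trans (by gcongr)
  exact le_of_tendsto ((ENNReal.continuous_rpow_const.tendsto _).comp
    (ENNReal.summable (f := f)).hasSum)
    (Filter.Eventually.of_forall fun F => (hfin F).trans (ENNReal.sum_le_tsum F))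

lemma korobovWeight_nonneg {d : ℕ} {α : ℝ} {γ : Fin d → ℝ} (hγ : ∀ i, 0 ≤ γ i) (h : Fin d → ℤ) :
    0 ≤ korobovWeight α γ h := by
  refine Finset.prod_nonneg fun i _ => ?_
  have := hγ i
  split_ifs <;> positivity

lemma ofReal_korobovWeight {d : ℕ} {α : ℝ} {γ : Fin d → ℝ} (hγ : ∀ i, 0 ≤ γ i) (h : Fin d → ℤ) :
    ENNReal.ofReal (korobovWeight α γ h) =
      ∏ i, if h i = 0 then 1 else ENNReal.ofReal (γ i) * absPow α (h i) := by
  rw [korobovWeight, ENNReal.ofReal_prod_of_nonneg]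
  · refine Finset.prod_congr rfl fun i _ => ?_
    split_ifs with h0
    · simp
    · rw [absPow, if_neg h0, ← ENNReal.ofReal_mul (hγ i), div_eq_mul_inv]
  · intro i _
    have := hγ i
    split_ifs <;> positivity

/-- The sum of all Fourier weights, each raised to the power `t`, factors over the coordinates. -/
lemma tsum_ofReal_korobovWeight_rpow {d : ℕ} {α : ℝ} {γ : Fin d → ℝ} (hγ : ∀ i, 0 ≤ γ i) {t : ℝ}
    (ht : 0 < t) :
    ∑' h, ENNReal.ofReal (korobovWeight α γ h) ^ t =
      ∏ i, (1 + ENNReal.ofReal (γ i) ^ t * ∑' k, absPow (α * t) k) := by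
  have hterm : ∀ h, ENNReal.ofReal (korobovWeight α γ h) ^ t =
      ∏ i, ((if h i = 0 then 1 else 0) + ENNReal.ofReal (γ i) ^ t * absPow (α * t) (h i)) :=
    fun h => by
      rw [ofReal_korobovWeight hγ, ← ENNReal.prod_rpow_of_nonneg ht.le]
      refine Finset.prod_congr rfl fun i _ => ?_
      split_ifs with h0
      · simp [h0, absPow]
      · rw [ENNReal.mul_rpow_of_nonneg _ _ ht.le, absPow_rpow α ht, zero_add]
  simp only [hterm]
  rw [ENNReal.tsum_fin_prod d fun i k =>
    (if k = 0 then 1 else 0) + ENNReal.ofReal (γ i) ^ t * absPow (α * t) k]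
  refine Finset.prod_congr rfl fun i _ => ?_
  rw [ENNReal.tsum_add, ENNReal.tsum_mul_left, tsum_ite_eq]

lemma tsum_ofReal_korobovWeight_ne_top {d : ℕ} {α : ℝ} (hα : 1 < α) {γ : Fin d → ℝ}
    (hγ : ∀ i, 0 ≤ γ i) : ∑' h, ENNReal.ofReal (korobovWeight α γ h) ≠ ⊤ := by
  have h := tsum_ofReal_korobovWeight_rpow (α := α) hγ one_pos
  simp only [ENNReal.rpow_one, mul_one] at h
  rw [h, tsum_absPow hα]
  exact ENNReal.prod_ne_top fun i _ => ENNReal.add_ne_top.2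
    ⟨ENNReal.one_ne_top, ENNReal.mul_ne_top ENNReal.ofReal_ne_top ENNReal.ofReal_ne_top⟩

/-- The squared worst-case error is the sum of the Fourier weights over the nonzero elements of the
dual lattice. -/
lemma worstCaseError_sq_eq_dualSum {d : ℕ} {α : ℝ} (hα : 1 < α) {γ : Fin d → ℝ}
    (hγ : ∀ i, 0 ≤ γ i) {N : ℕ} (hN : N ≠ 0) (z : Fin d → ℕ) :
    worstCaseError α γ N z ^ 2 = dualSum α γ N z :=
  le_antisymm (worstCaseError_sq_le_dualSum hN z (tsum_ofReal_korobovWeight_ne_top hα hγ))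
    (dualSum_le_worstCaseError_sq hN z (korobovWeight_nonneg hγ))

/-! ### Adding one component -/

open Classical in
/-- The dual frequencies in dimension `d + 1` are split into those with vanishing last component,
which are dual in dimension `d`, and the others. -/
lemma dualSum_succ_le {d : ℕ} {α : ℝ} {γ : Fin (d + 1) → ℝ} (hγ : ∀ i, 0 ≤ γ i) (N : ℕ)
    (y : Fin (d + 1) → ℕ) :
    dualSum α γ N y ≤ dualSum α (fun i => γ i.castSucc) N (fun i => y i.castSucc) +
      ∑' h : Fin d → ℤ, ∑' k : ℤ,
        ENNReal.ofReal (korobovWeight α (fun i => γ i.castSucc) h) *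
          (ENNReal.ofReal (γ (Fin.last d)) *
            if (N : ℤ) ∣ (∑ i, h i * (y i.castSucc : ℤ)) + k * (y (Fin.last d) : ℤ)
              then absPow α k else 0) := by
  have h0 : dualSum α (fun i => γ i.castSucc) N (fun i => y i.castSucc) =
      ∑' h : Fin d → ℤ, ∑' k : ℤ, if k = 0 then
        (if IsDualFreq N (fun i => y i.castSucc) h then
          ENNReal.ofReal (korobovWeight α (fun i => γ i.castSucc) h) else 0) else 0 := by
    simp only [tsum_ite_eq]
    rfl
  rw [h0, dualSum, ← (Fin.snocEquiv fun _ : Fin (d + 1) => ℤ).tsum_eq, ENNReal.tsum_prod',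
    ENNReal.tsum_comm, ← ENNReal.tsum_add]
  refine ENNReal.tsum_le_tsum fun h => ?_
  rw [← ENNReal.tsum_add]
  refine ENNReal.tsum_le_tsum fun k => ?_
  have hsum : ∑ i, (Fin.snocEquiv (fun _ : Fin (d + 1) => ℤ) (k, h)) i * (y i : ℤ) =
      (∑ i, h i * (y i.castSucc : ℤ)) + k * (y (Fin.last d) : ℤ) := by
    rw [Fin.sum_univ_castSucc]
    simp [Fin.snocEquiv]
  have hwt : ENNReal.ofReal (korobovWeight α γ (Fin.snocEquiv (fun _ : Fin (d + 1) => ℤ) (k, h))) =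
      ENNReal.ofReal (korobovWeight α (fun i => γ i.castSucc) h) *
        if k = 0 then 1 else ENNReal.ofReal (γ (Fin.last d)) * absPow α k := by
    rw [ofReal_korobovWeight hγ, ofReal_korobovWeight fun i => hγ i.castSucc,
      Fin.prod_univ_castSucc]
    simp [Fin.snocEquiv]
  by_cases hdual : IsDualFreq N y (Fin.snocEquiv (fun _ : Fin (d + 1) => ℤ) (k, h))
  swap
  · rw [if_neg hdual]
    exact zero_le
  rw [if_pos hdual, hwt]
  obtain ⟨hne, hdvd⟩ := hdual
  rw [hsum] at hdvd
  by_cases hk : k = 0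
  · subst hk
    have hh : IsDualFreq N (fun i => y i.castSucc) h := by
      refine ⟨?_, by simpa using hdvd⟩
      rintro rfl
      refine hne ?_
      ext i
      refine Fin.lastCases ?_ (fun i => ?_) i <;> simp [Fin.snocEquiv]
    simp [hh]
  · simp [hk, hdvd]

/-- The averaging step: if the last component `b ^ w * x`, for every `x` in a set `A` of candidates,
is no better than the one chosen, then the new frequencies contribute to the error of the chosen
vector at most the average over `A` of their contributions. -/
lemma card_mul_dualSum_succ_rpow_le {b m w : ℕ} (hb : b.Prime) {d : ℕ} {α t : ℝ} (ht : 0 < t)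
    (ht1 : t ≤ 1) (hαt : 1 ≤ α * t) {γ : Fin (d + 1) → ℝ} (hγ : ∀ i, 0 ≤ γ i)
    {A : Finset ℕ} (hA : A ⊆ searchSpace b m w) (y : Fin (d + 1) → ℕ)
    (hmin : ∀ x ∈ A, dualSum α γ (b ^ m) y ≤
      dualSum α γ (b ^ m) (Function.update y (Fin.last d) (b ^ w * x))) :
    (A.card : ℝ≥0∞) * dualSum α γ (b ^ m) y ^ t ≤
      A.card * dualSum α (fun i => γ i.castSucc) (b ^ m) (fun i => y i.castSucc) ^ t +
        (∏ i : Fin d, (1 + ENNReal.ofReal (γ i.castSucc) ^ t * ∑' k, absPow (α * t) k)) *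
          (ENNReal.ofReal (γ (Fin.last d)) ^ t * ∑' k, absPow (α * t) k) := by
  classical
  set W := fun h : Fin d → ℤ => ENNReal.ofReal (korobovWeight α (fun i => γ i.castSucc) h)
  set c := fun h : Fin d → ℤ => ∑ i, h i * (y i.castSucc : ℤ)
  set S := dualSum α (fun i => γ i.castSucc) (b ^ m) (fun i => y i.castSucc)
  set G := ENNReal.ofReal (γ (Fin.last d))
  have hstep : ∀ x ∈ A, dualSum α γ (b ^ m) y ^ t ≤ S ^ t + ∑' h, W h ^ t * (G ^ t * ∑' k : ℤ,
      if ((b ^ m : ℕ) : ℤ) ∣ c h + k * ((b ^ w * x : ℕ) : ℤ) then absPow (α * t) k else 0) := by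
    intro x hx
    have h1 := (hmin x hx).trans (dualSum_succ_le hγ _ _)
    simp only [Function.update_self, ne_eq, Fin.castSucc_ne_last, not_false_eq_true,
      Function.update_of_ne] at h1
    refine (ENNReal.rpow_le_rpow h1 ht.le).trans ?_
    refine (ENNReal.rpow_add_le_add_rpow _ _ ht.le ht1).trans ?_
    refine add_le_add le_rfl ?_
    refine (ENNReal.tsum_rpow_le_tsum_rpow _ ht ht1).trans (ENNReal.tsum_le_tsum fun h => ?_)
    rw [← ENNReal.tsum_mul_left, ← ENNReal.tsum_mul_left]
    refine (ENNReal.tsum_rpow_le_tsum_rpow _ ht ht1).trans (ENNReal.tsum_le_tsum fun k => ?_)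
    rw [ENNReal.mul_rpow_of_nonneg _ _ ht.le, ENNReal.mul_rpow_of_nonneg _ _ ht.le]
    refine le_of_eq ?_
    congr 2
    split_ifs
    · exact absPow_rpow α ht k
    · simp [ht]
  calc (A.card : ℝ≥0∞) * dualSum α γ (b ^ m) y ^ t
      = ∑ x ∈ A, dualSum α γ (b ^ m) y ^ t := by simp
    _ ≤ ∑ x ∈ A, (S ^ t + ∑' h, W h ^ t * (G ^ t * ∑' k : ℤ,
          if ((b ^ m : ℕ) : ℤ) ∣ c h + k * ((b ^ w * x : ℕ) : ℤ) then absPow (α * t) k else 0)) :=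
        Finset.sum_le_sum hstep
    _ = A.card * S ^ t + ∑' h, W h ^ t * (G ^ t * ∑ x ∈ A, ∑' k : ℤ,
          if ((b ^ m : ℕ) : ℤ) ∣ c h + k * ((b ^ w * x : ℕ) : ℤ) then absPow (α * t) k else 0) := by
        rw [Finset.sum_add_distrib, ← Summable.tsum_finsetSum fun _ _ => ENNReal.summable]
        simp [Finset.mul_sum]
    _ ≤ A.card * S ^ t + ∑' h, W h ^ t * (G ^ t * ∑' k, absPow (α * t) k) := by
        gcongr with h
        exact sum_searchSpace_tsum_absPow_le hb hαt hA (c h)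
    _ = _ := by
        rw [ENNReal.tsum_mul_right, tsum_ofReal_korobovWeight_rpow (fun i => hγ i.castSucc) ht]

/-! ### Runs of the algorithm -/

lemma riemannZeta_re_nonneg {β : ℝ} (hβ : 1 < β) : 0 ≤ (riemannZeta (β : ℂ)).re := by
  have h1 : (1 : ℝ≥0∞) ≤ ∑' k, absPow β k := by
    refine le_trans ?_ (ENNReal.le_tsum (1 : ℤ))
    simp [absPow]
  rw [tsum_absPow hβ, ENNReal.one_le_ofReal] at h1
  linarith

lemma dualSum_congr {d : ℕ} {α : ℝ} {γ : Fin d → ℝ} {N : ℕ} {y y' : Fin d → ℕ}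
    (h : ∀ k : Fin d → ℤ, (N : ℤ) ∣ ∑ i, k i * (y i : ℤ) ↔ (N : ℤ) ∣ ∑ i, k i * (y' i : ℤ)) :
    dualSum α γ N y = dualSum α γ N y' := by
  have : IsDualFreq N y = IsDualFreq N y' := by
    ext k
    rw [IsDualFreq, IsDualFreq, h]
  rw [dualSum, dualSum, this]

lemma dualSum_fin_zero (α : ℝ) (γ : Fin 0 → ℝ) (N : ℕ) (y : Fin 0 → ℕ) :
    dualSum α γ N y = 0 := by
  have : ∀ h, ¬ IsDualFreq N y h := fun h hh => hh.1 (Subsingleton.elim _ _)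
  simp [dualSum, this]

lemma Fin.prod_univ_add_one_eq_prod_Icc {M : Type*} [CommMonoid M] (f : ℕ → M) (d : ℕ) :
    ∏ i : Fin d, f (i + 1) = ∏ j ∈ Finset.Icc 1 d, f j := by
  induction d with
  | zero => simp
  | succ d ih => rw [Fin.prod_univ_castSucc, Finset.prod_Icc_succ_top (by omega), ← ih]; simp

section CBCRun

variable {α : ℝ} {γ : ℕ → ℝ} {b m s : ℕ} {w : ℕ → ℕ} {E : ℕ → Finset ℕ} {z : ℕ → ℕ}

lemma IsCBCRun.exclusion_ssubset (hz : IsCBCRun α γ b m s w E z) (hb : b.Prime) {d : ℕ}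
    (hd : d + 1 ≤ s) : E (d + 1) ⊂ searchSpace b m (w (d + 1)) := by
  have hne : (searchSpace b m (w (d + 1))).Nonempty := by
    rw [← Finset.card_pos, card_searchSpace hb]
    exact Nat.totient_pos.2 (pow_pos hb.pos _)
  rcases Nat.eq_zero_or_pos d with rfl | hd0
  · rw [zero_add, hz.init.2]
    exact Finset.empty_ssubset.2 hne
  · by_cases hw : w (d + 1) < m
    · exact (hz.step d hd0 hd hw).1
    · rw [(hz.final d hd0 hd (not_lt.1 hw)).2]
      exact Finset.empty_ssubset.2 hne

/-- The chosen component is optimal among the candidates that are not excluded. This is the rule of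
the algorithm for `w (d + 1) < m`. In the other cases all candidates give the same dual lattice:
for the first component because the candidates are units modulo `b ^ m`, and for
`w (d + 1) ≥ m` because `b ^ w (d + 1)` vanishes modulo `b ^ m`. -/
lemma IsCBCRun.dualSum_le (hz : IsCBCRun α γ b m s w E z) (hα : 1 < α) (hb : b.Prime) (hm : 1 ≤ m)
    (hγ : ∀ j ∈ Set.Icc 1 s, 0 ≤ γ j) (hw1 : w 1 = 0) {d : ℕ} (hd : d + 1 ≤ s) {x : ℕ}
    (hx : x ∈ searchSpace b m (w (d + 1)) \ E (d + 1)) :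
    dualSum α (fun i : Fin (d + 1) => γ (i + 1)) (b ^ m)
        (fun i : Fin (d + 1) => scaled b w z (i + 1)) ≤
      dualSum α (fun i : Fin (d + 1) => γ (i + 1)) (b ^ m)
        (Function.update (fun i : Fin (d + 1) => scaled b w z (i + 1)) (Fin.last d)
          (b ^ w (d + 1) * x)) := by
  rcases Nat.eq_zero_or_pos d with rfl | hd0
  · rw [zero_add, hw1, hz.init.2, Finset.sdiff_empty, mem_searchSpace_iff hb (by omega),
      Nat.sub_zero] at hx
    refine le_of_eq (dualSum_congr fun k => ?_)
    have hco : IsCoprime (((b ^ m : ℕ) : ℤ)) (x : ℤ) := Nat.isCoprime_iff_coprime.2 hx.2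
    suffices hiff : (b : ℤ) ^ m ∣ k 0 ↔ (b : ℤ) ^ m ∣ k 0 * (x : ℤ) by
      simpa [scaled, hw1, hz.init.1] using hiff
    constructor
    · exact fun h => h.mul_right _
    · intro h
      push_cast at hco
      exact hco.dvd_of_dvd_mul_right h
  · by_cases hw : w (d + 1) < m
    · have h := (hz.step d hd0 hd hw).2.2 x hx
      have hγ' : ∀ i : Fin (d + 1), 0 ≤ γ (i + 1) := fun i => hγ _ ⟨by omega, by omega⟩
      have hN : b ^ m ≠ 0 := pow_ne_zero _ hb.ne_zero
      rw [sqError, sqError, worstCaseError_sq_eq_dualSum hα hγ' hN,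
        worstCaseError_sq_eq_dualSum hα hγ' hN] at h
      refine h.trans (le_of_eq ?_)
      congr 1
      ext i
      refine Fin.lastCases ?_ (fun i => ?_) i
      · simp [scaled]
      · have : (i : ℕ) ≠ d := i.2.ne
        simp [scaled, Function.update_of_ne, this]
    · have hdvd : ((b ^ m : ℕ) : ℤ) ∣ ((b ^ w (d + 1) : ℕ) : ℤ) := by
        exact_mod_cast pow_dvd_pow b (not_lt.1 hw)
      refine le_of_eq (dualSum_congr fun k => ?_)
      rw [Fin.sum_univ_castSucc, Fin.sum_univ_castSucc]
      have h1 : ((b ^ m : ℕ) : ℤ) ∣ k (Fin.last d) * ((b ^ w (d + 1) * x : ℕ) : ℤ) := by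
        rw [Nat.cast_mul]
        exact (hdvd.mul_right _).mul_left _
      simp only [Function.update_self, ne_eq, Fin.castSucc_ne_last, not_false_eq_true,
        Function.update_of_ne, Fin.val_last, scaled, (hz.final d hd0 hd (not_lt.1 hw)).1]
      rw [dvd_add_left h1]
      simp

/-- The quantity bounding `e ^ (2 λ)` in dimension `d`. -/
noncomputable def cbcBound (α lam : ℝ) (γ : ℕ → ℝ) (b m : ℕ) (w : ℕ → ℕ) (E : ℕ → Finset ℕ)
    (d : ℕ) : ℝ :=
  ∑ u ∈ (Finset.Icc 1 d).powerset,
    (∏ j ∈ u, γ j) ^ lam * (4 * (riemannZeta ((α * lam : ℝ) : ℂ)).re) ^ u.card /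
      (Nat.totient (b ^ (m - u.sup w)) : ℝ) *
      ∏ j ∈ u, ((searchSpace b m (w j)).card : ℝ) /
        (((searchSpace b m (w j)).card : ℝ) - ((E j).card : ℝ))

/-- As the `w j` increase, the subsets containing the new index `d + 1` all have the same totient in
the denominator, so that their contribution is a product over the old indices. -/
lemma cbcBound_succ {lam : ℝ} (hb : b.Prime) (hγ : ∀ j ∈ Set.Icc 1 s, 0 ≤ γ j)
    (hw : MonotoneOn w (Set.Icc 1 s)) {d : ℕ} (hd : d + 1 ≤ s) :
    cbcBound α lam γ b m w E (d + 1) = cbcBound α lam γ b m w E d +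
      γ (d + 1) ^ lam * (4 * (riemannZeta ((α * lam : ℝ) : ℂ)).re) /
        (((searchSpace b m (w (d + 1))).card : ℝ) - ((E (d + 1)).card : ℝ)) *
        ∏ j ∈ Finset.Icc 1 d, (1 + γ j ^ lam * (4 * (riemannZeta ((α * lam : ℝ) : ℂ)).re) *
          (((searchSpace b m (w j)).card : ℝ) /
            (((searchSpace b m (w j)).card : ℝ) - ((E j).card : ℝ)))) := by
  have hIcc : Finset.Icc 1 (d + 1) = insert (d + 1) (Finset.Icc 1 d) := by
    ext x; simp only [Finset.mem_Icc, Finset.mem_insert]; omega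
  rw [cbcBound, hIcc, Finset.sum_powerset_insert (by simp), Finset.prod_one_add, Finset.mul_sum]
  refine congrArg₂ _ rfl (Finset.sum_congr rfl fun u hu => ?_)
  rw [Finset.mem_powerset] at hu
  have hmem : d + 1 ∉ u := fun h => by simpa using hu h
  have hsup : (insert (d + 1) u).sup w = w (d + 1) := by
    rw [Finset.sup_insert, sup_eq_left]
    refine Finset.sup_le fun j hj => ?_
    have := Finset.mem_Icc.1 (hu hj)
    exact hw ⟨this.1, by omega⟩ ⟨by omega, hd⟩ (by omega)
  have hγu : ∀ j ∈ u, 0 ≤ γ j := fun j hj => by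
    have := Finset.mem_Icc.1 (hu hj)
    exact hγ j ⟨this.1, by omega⟩
  have hcard : ((searchSpace b m (w (d + 1))).card : ℝ) ≠ 0 := by
    rw [card_searchSpace hb]
    exact_mod_cast (Nat.totient_pos.2 (pow_pos hb.pos _)).ne'
  rw [hsup, ← card_searchSpace hb, Finset.prod_insert hmem, Finset.prod_insert hmem,
    Finset.card_insert_of_notMem hmem,
    Real.mul_rpow (hγ _ ⟨by omega, hd⟩) (Finset.prod_nonneg hγu),
    ← Real.finsetProd_rpow u γ hγu, Finset.prod_mul_distrib, Finset.prod_mul_distrib,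
    Finset.prod_const, pow_succ]
  field_simp

/-- Induction on the dimension, by the averaging step. -/
lemma IsCBCRun.dualSum_rpow_le (hz : IsCBCRun α γ b m s w E z) (hα : 1 < α) (hb : b.Prime)
    (hm : 1 ≤ m) (hγ : ∀ j ∈ Set.Icc 1 s, 0 ≤ γ j) (hw1 : w 1 = 0)
    (hw : MonotoneOn w (Set.Icc 1 s)) {lam : ℝ} (hlam : 1 / α < lam) (hlam1 : lam ≤ 1) {d : ℕ}
    (hd : d ≤ s) :
    dualSum α (fun i : Fin d => γ (i + 1)) (b ^ m) (fun i : Fin d => scaled b w z (i + 1)) ^ lam ≤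
      ENNReal.ofReal (cbcBound α lam γ b m w E d) := by
  have hα0 : 0 < α := by linarith
  have hlam0 : 0 < lam := lt_trans (by positivity) hlam
  have hαlam : 1 < α * lam := by rwa [div_lt_iff₀' hα0] at hlam
  induction d with
  | zero => simp [dualSum_fin_zero, hlam0]
  | succ d ih =>
    have hγ' : ∀ i : Fin (d + 1), 0 ≤ γ (i + 1) := fun i => hγ _ ⟨by omega, by omega⟩
    have key := card_mul_dualSum_succ_rpow_le hb hlam0 hlam1 hαlam.le hγ' Finset.sdiff_subset
      (fun i : Fin (d + 1) => scaled b w z (i + 1))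
      (fun x hx => hz.dualSum_le hα hb hm hγ hw1 hd hx)
    have ih' := ih (by omega)
    have hζ := riemannZeta_re_nonneg hαlam
    rw [tsum_absPow hαlam] at key
    set ζ := (riemannZeta ((α * lam : ℝ) : ℂ)).re with hζdef
    set a : ℝ := ((searchSpace b m (w (d + 1))).card : ℝ) - ((E (d + 1)).card : ℝ) with ha
    have hss : ∀ j ∈ Finset.Icc 1 (d + 1), E j ⊂ searchSpace b m (w j) := fun j hj => by
      obtain ⟨h1, h2⟩ := Finset.mem_Icc.1 hj
      obtain ⟨i, rfl⟩ : ∃ i, j = i + 1 := ⟨j - 1, by omega⟩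
      exact hz.exclusion_ssubset hb (by omega)
    have hapos : 0 < a := by
      have := Finset.card_lt_card (hss (d + 1) (by simp))
      rw [ha, sub_pos]
      exact_mod_cast this
    have hcardA : (((searchSpace b m (w (d + 1)) \ E (d + 1)).card : ℕ) : ℝ≥0∞) =
        ENNReal.ofReal a := by
      rw [Finset.card_sdiff_of_subset (hss (d + 1) (by simp)).subset, ← ENNReal.ofReal_natCast,
        Nat.cast_sub (Finset.card_le_card (hss (d + 1) (by simp)).subset)]
    have hγn : ∀ j ∈ Finset.Icc 1 (d + 1), 0 ≤ γ j := fun j hj => by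
      obtain ⟨h1, h2⟩ := Finset.mem_Icc.1 hj
      exact hγ j ⟨h1, by omega⟩
    have hsub : ∀ j ∈ Finset.Icc 1 d, j ∈ Finset.Icc 1 (d + 1) := fun j hj => by
      rw [Finset.mem_Icc] at hj ⊢; omega
    have hprod : ∏ i : Fin d, (1 + ENNReal.ofReal (γ (i + 1)) ^ lam * ENNReal.ofReal (2 * ζ)) =
        ENNReal.ofReal (∏ j ∈ Finset.Icc 1 d, (1 + γ j ^ lam * (2 * ζ))) := by
      rw [Fin.prod_univ_add_one_eq_prod_Icc
        (fun j => 1 + ENNReal.ofReal (γ j) ^ lam * ENNReal.ofReal (2 * ζ)),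
        ENNReal.ofReal_prod_of_nonneg fun j hj => ?_]
      · refine Finset.prod_congr rfl fun j hj => ?_
        have h0 := hγn j (hsub j hj)
        rw [ENNReal.ofReal_add zero_le_one (by positivity),
          ENNReal.ofReal_mul (p := γ j ^ lam) (by positivity),
          ENNReal.ofReal_rpow_of_nonneg h0 hlam0.le, ENNReal.ofReal_one]
      · have h0 := hγn j (hsub j hj)
        positivity
    have hγd := hγn (d + 1) (by simp)
    set Q : ℝ := (∏ j ∈ Finset.Icc 1 d, (1 + γ j ^ lam * (2 * ζ))) * (γ (d + 1) ^ lam * (2 * ζ))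
    have hP0 : 0 ≤ ∏ j ∈ Finset.Icc 1 d, (1 + γ j ^ lam * (2 * ζ)) :=
      Finset.prod_nonneg fun j hj => by have h0 := hγn j (hsub j hj); positivity
    have hQ : ENNReal.ofReal Q =
        (∏ i : Fin d, (1 + ENNReal.ofReal (γ (i + 1)) ^ lam * ENNReal.ofReal (2 * ζ))) *
        (ENNReal.ofReal (γ (d + 1)) ^ lam * ENNReal.ofReal (2 * ζ)) := by
      rw [hprod, ENNReal.ofReal_mul hP0, ENNReal.ofReal_mul (by positivity),
        ENNReal.ofReal_rpow_of_nonneg hγd hlam0.le]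
    simp only [Fin.val_castSucc, Fin.val_last] at key
    rw [hcardA, ← hQ] at key
    have hQa : ENNReal.ofReal Q = ENNReal.ofReal a * ENNReal.ofReal (Q / a) := by
      rw [← ENNReal.ofReal_mul hapos.le, mul_div_cancel₀ _ hapos.ne']
    rw [hQa, ← mul_add,
      ENNReal.mul_le_mul_iff_right (by simpa using hapos) ENNReal.ofReal_ne_top] at key
    have hB0 : 0 ≤ cbcBound α lam γ b m w E d := by
      refine Finset.sum_nonneg fun u hu => ?_
      rw [Finset.mem_powerset] at hu
      have h1 : 0 ≤ ∏ j ∈ u, γ j := Finset.prod_nonneg fun j hj => hγn j (hsub j (hu hj))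
      refine mul_nonneg (by positivity) (Finset.prod_nonneg fun j hj => ?_)
      have := Finset.card_lt_card (hss j (hsub j (hu hj)))
      refine div_nonneg (by positivity) (sub_nonneg.2 ?_)
      exact_mod_cast this.le
    refine key.trans ((add_le_add ih' le_rfl).trans ?_)
    rw [← ENNReal.ofReal_add hB0 (by positivity)]
    refine ENNReal.ofReal_le_ofReal ?_
    rw [cbcBound_succ hb hγ hw hd, ← ha, ← hζdef]
    refine add_le_add le_rfl ?_
    have hle : ∏ j ∈ Finset.Icc 1 d, (1 + γ j ^ lam * (2 * ζ)) ≤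
        ∏ j ∈ Finset.Icc 1 d, (1 + γ j ^ lam * (4 * ζ) * (((searchSpace b m (w j)).card : ℝ) /
          (((searchSpace b m (w j)).card : ℝ) - ((E j).card : ℝ)))) := by
      refine Finset.prod_le_prod (fun j hj => ?_) fun j hj => ?_
      · have h0 := hγn j (hsub j hj); positivity
      · have h0 := Real.rpow_nonneg (hγn j (hsub j hj)) lam
        have h1 : ((E j).card : ℝ) < (searchSpace b m (w j)).card := by
          exact_mod_cast Finset.card_lt_card (hss j (hsub j hj))
        have h2 : 1 ≤ ((searchSpace b m (w j)).card : ℝ) /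
            (((searchSpace b m (w j)).card : ℝ) - ((E j).card : ℝ)) := by
          rw [one_le_div (by linarith)]
          have : (0 : ℝ) ≤ (E j).card := by positivity
          linarith
        have h3 : γ j ^ lam * (2 * ζ) ≤ γ j ^ lam * (4 * ζ) :=
          mul_le_mul_of_nonneg_left (by linarith) h0
        have h4 := le_mul_of_one_le_right (show 0 ≤ γ j ^ lam * (4 * ζ) by positivity) h2
        linarith
    calc Q / a = γ (d + 1) ^ lam * (2 * ζ) / a *
          ∏ j ∈ Finset.Icc 1 d, (1 + γ j ^ lam * (2 * ζ)) := by
          simp only [Q]; ring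
      _ ≤ _ := by
          refine mul_le_mul ?_ hle hP0 (by positivity)
          gcongr
          norm_num

end CBCRun

theorem mainTheorem1 (α : ℝ) (hα : 1 < α) (γ : ℕ → ℝ) (b m s : ℕ) (hb : b.Prime) (hm : 1 ≤ m)
    (hγ : ∀ j ∈ Set.Icc 1 s, 0 ≤ γ j)
    (w : ℕ → ℕ) (hw1 : w 1 = 0) (hw : MonotoneOn w (Set.Icc 1 s))
    (E : ℕ → Finset ℕ) (z : ℕ → ℕ) (hz : IsCBCRun α γ b m s w E z)
    (d : ℕ) (hd1 : 1 ≤ d) (hds : d ≤ s) (lam : ℝ) (hlam : 1 / α < lam) (hlam1 : lam ≤ 1) :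
    sqError α γ (b ^ m) d (scaled b w z) ≤
      ENNReal.ofReal
        ((∑ u ∈ (Finset.Icc 1 d).powerset,
            (∏ j ∈ u, γ j) ^ lam * (4 * (riemannZeta ((α * lam : ℝ) : ℂ)).re) ^ u.card /
              (Nat.totient (b ^ (m - u.sup w)) : ℝ) *
              ∏ j ∈ u, ((searchSpace b m (w j)).card : ℝ) /
                (((searchSpace b m (w j)).card : ℝ) - ((E j).card : ℝ))) ^ (1 / lam)) := by
  have hlam0 : 0 < lam := lt_trans (by positivity) hlam
  have hbound := hz.dualSum_rpow_le hα hb hm hγ hw1 hw hlam hlam1 hds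
  change _ ≤ ENNReal.ofReal (cbcBound α lam γ b m w E d ^ (1 / lam))
  rw [sqError, worstCaseError_sq_eq_dualSum hα (fun i => hγ _ ⟨by omega, by omega⟩)
    (pow_ne_zero _ hb.ne_zero)]
  calc _ ≤ ENNReal.ofReal (cbcBound α lam γ b m w E d) ^ (1 / lam) := by
        rw [one_div, ENNReal.le_rpow_inv_iff hlam0]
        exact hbound
    _ ≤ _ := by
        -- a negative bound would have `ENNReal.ofReal` equal to `0`, so its sign need not be known
        rcases le_total 0 (cbcBound α lam γ b m w E d) with h0 | h0
        · rw [ENNReal.ofReal_rpow_of_nonneg h0 (by positivity)]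
        · rw [ENNReal.ofReal_eq_zero.2 h0, ENNReal.zero_rpow_of_pos (by positivity)]
          exact zero_le
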